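/- **Setting.** Let $\mathcal H_A=\mathbb C^{d_A}$, $\mathcal H_B=\mathbb C^{d_B}$, and let $\mathscr B=\{\mathcal B_x\}_{x=1}^m$, $m\ge 1$, $\mathcal B_x=\{|\psi_{xk}\rangle\}_{k}$, be a family of orthonormal bases of $\mathcal H_A$. The transition graph $G(\mathscr B)$ has one vertex for each pair $(x,k)$, and two different vertices are adjacent iff the corresponding basis states are not orthogonal. Let $G_1,\dots,G_g$ be its connected components. For each $a$ let $P_a=\sum_{k:(x,k)\in G_a}|\psi_{xk}\rangle\langle\psi_{xk}|$ be the component projector (it does not depend on $x$), $r_a=\operatorname{tr}P_a$ the component rank, and $r_{\min}=\min_a r_a$. A state (density operator) $\rho$ on $\mathcal H_A\otimes\mathcal H_B$ is a *zero-uncertainty state* with respect to $\mathscr B$ if for every $x$ there is a POVM $\{\Pi_{xk}\}_k$ on $\mathcal H_B$ with $\sum_k\operatorname{tr}[\rho(|\psi_{xk}\rangle\langle\psi_{xk}|\otimes\Pi_{xk})]=1$. Its component vector is $(q_a)_a$ with $q_a=\operatorname{tr}[\rho(P_a\otimes 1)]$, and $\rho_{\mathscr B}=\sum_a(P_a\otimes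 1)\rho(P_a\otimes 1)$. For $r\ge1$ let $\Phi(r)$ be a pure maximally entangled state of Schmidt rank $r$, i.e. the state with vector $|\Phi(r)\rangle=r^{-1/2}\sum_{l=1}^r|u_l\rangle\otimes|v_l\rangle$ with $(u_l)$ and $(v_l)$ orthonormal families in some $\mathbb C^{m_r}$ and $\mathbb C^{n_r}$. Let $E$ be an entanglement measure, i.e. a real-valued function on the bipartite states of all finite dimensions that does not increase on average under LOCC, selective or nonselective: whenever an LOCC protocol (finitely many rounds of local measurements, each of which may depend on the earlier outcomes, and in which part or all of the classical record may be discarded) turns a state $\rho$ into states $\rho_o$ with probabilities $p_o$, one has $\sum_o p_oE(\rho_o)\le E(\rho)$. **Theorem.** Every zero-uncertainty state $\rho$ with respect to $\mathscr B$, with component vector $(q_a)_a$, satisfies $$E(\rho)\ \ge\ E(\rho_{\mathscr B})\ \ge\ \sum_a q_a\,E(\Phi(r_a))\ \ge\ E(\Phi(r_{\min})).$$ The second inequality is an equality if $E$ is convex on the states of each bipartite system. -/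

import Mathlib

open scoped Kronecker ComplexOrder

namespace ZeroUncertainty

/-- Operators on `ℂ^m ⊗ ℂ^n`: Alice's factor is the first index, Bob's the second. -/
abbrev BiOp (m n : ℕ) : Type := Matrix (Fin m × Fin n) (Fin m × Fin n) ℂ

/-- `ρ` is a density operator. -/
def IsState {ι : Type} [Fintype ι] (ρ : Matrix ι ι ℂ) : Prop :=
  ρ.PosSemidef ∧ ρ.trace = 1

/-- The operator `|ψ⟩⟨ψ|`. -/
def ketBra {ι : Type} (ψ : ι → ℂ) : Matrix ι ι ℂ :=
  Matrix.vecMulVec ψ (star ψ)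

/-! ### LOCC -/

/-- A (finite-round) LOCC protocol from `ℂ^m ⊗ ℂ^n` to `ℂ^m' ⊗ ℂ^n'` whose classical record is
a label in `O`.  In each round one party performs a local measurement given by Kraus operators
`K i` (which may enlarge or reduce the local space) and communicates the outcome `i`, on which
the rest of the protocol may depend.  A protocol that stops announces a label. Several branches
may announce the same label, so that part of the record, or all of it, can be forgotten. -/
inductive LOCC (O : Type) (m' n' : ℕ) : ℕ → ℕ → Type
  | done (o : O) : LOCC O m' n' m' n'
  | alice {m n : ℕ} (k d : ℕ) (K : Fin k → Matrix (Fin d) (Fin m) ℂ)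
      (hK : ∑ i, (K i).conjTranspose * K i = 1) (next : Fin k → LOCC O m' n' d n) :
      LOCC O m' n' m n
  | bob {m n : ℕ} (k d : ℕ) (K : Fin k → Matrix (Fin d) (Fin n) ℂ)
      (hK : ∑ i, (K i).conjTranspose * K i = 1) (next : Fin k → LOCC O m' n' m d) :
      LOCC O m' n' m n

/-- The unnormalized output `Λ_o(ρ)` of the protocol for the label `o`; its trace is the
probability of `o`. -/
noncomputable def LOCC.run {O : Type} [DecidableEq O] {m' n' : ℕ} :
    {m n : ℕ} → LOCC O m' n' m n → BiOp m n → O → BiOp m' n'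
  | _, _, .done o, ρ, o' => if o = o' then ρ else 0
  | _, n, .alice _ _ K _ next, ρ, o =>
      ∑ i, (next i).run
        ((K i ⊗ₖ (1 : Matrix (Fin n) (Fin n) ℂ)) * ρ *
          (K i ⊗ₖ (1 : Matrix (Fin n) (Fin n) ℂ)).conjTranspose) o
  | m, _, .bob _ _ K _ next, ρ, o =>
      ∑ i, (next i).run
        (((1 : Matrix (Fin m) (Fin m) ℂ) ⊗ₖ K i) * ρ *
          ((1 : Matrix (Fin m) (Fin m) ℂ) ⊗ₖ K i).conjTranspose) o

/-- The probability of the label `o`. -/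
noncomputable def LOCC.prob {O : Type} [DecidableEq O] {m' n' m n : ℕ}
    (P : LOCC O m' n' m n) (ρ : BiOp m n) (o : O) : ℝ :=
  (P.run ρ o).trace.re

/-- The normalized output state for the label `o` (meaningful when `o` has positive
probability). -/
noncomputable def LOCC.post {O : Type} [DecidableEq O] {m' n' m n : ℕ}
    (P : LOCC O m' n' m n) (ρ : BiOp m n) (o : O) : BiOp m' n' :=
  (P.prob ρ o)⁻¹ • P.run ρ o

/-- The function `E`, given on the bipartite states of all finite dimensions, does not increase
on average under LOCC: `∑ₒ pₒ E(ρₒ) ≤ E(ρ)`. With a single label (`s = 1`) this is monotonicity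
under nonselective LOCC. Only the values of `E` at states matter. -/
def IsEntanglementMonotone (E : ∀ m n : ℕ, BiOp m n → ℝ) : Prop :=
  ∀ (m n m' n' s : ℕ) (P : LOCC (Fin s) m' n' m n) (ρ : BiOp m n), IsState ρ →
    ∑ o, P.prob ρ o * E m' n' (P.post ρ o) ≤ E m n ρ

/-- `E` is convex on the states of every bipartite system. -/
def IsConvexMeasure (E : ∀ m n : ℕ, BiOp m n → ℝ) : Prop :=
  ∀ m n : ℕ, ConvexOn ℝ {ρ : BiOp m n | IsState ρ} (E m n)

/-- `σ` is a pure maximally entangled state of Schmidt rank `r`: `σ = |Ψ⟩⟨Ψ|` with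
`|Ψ⟩ = r^(-1/2) ∑ₗ |uₗ⟩ ⊗ |vₗ⟩` for orthonormal families `u`, `v` of `r` vectors. -/
def IsPureMES (r : ℕ) {m n : ℕ} (σ : BiOp m n) : Prop :=
  ∃ (u : Fin r → EuclideanSpace ℂ (Fin m)) (v : Fin r → EuclideanSpace ℂ (Fin n)),
    Orthonormal ℂ u ∧ Orthonormal ℂ v ∧
      σ = ketBra (fun p => ((√(r : ℝ) : ℝ) : ℂ)⁻¹ * ∑ l, u l p.1 * v l p.2)

/-! ### Basis sets, transition graphs and zero-uncertainty states -/

/-- `m` orthonormal bases of `ℂ^d`. -/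
abbrev BasisSet (m d : ℕ) : Type :=
  Fin m → OrthonormalBasis (Fin d) ℂ (EuclideanSpace ℂ (Fin d))

variable {m d : ℕ}

/-- The projector `|ψ_{xk}⟩⟨ψ_{xk}|`. -/
noncomputable def basisProj (B : BasisSet m d) (x : Fin m) (k : Fin d) : Matrix (Fin d) (Fin d) ℂ :=
  ketBra (fun i => B x k i)

/-- The transition graph: one vertex for each basis state, two different vertices being adjacent
iff the states are not orthogonal. -/
def transitionGraph (B : BasisSet m d) : SimpleGraph (Fin m × Fin d) where
  Adj p q := p ≠ q ∧ inner ℂ (B p.1 p.2) (B q.1 q.2) ≠ 0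
  symm := ⟨fun _ _ h => ⟨h.1.symm, fun h0 => h.2 (inner_eq_zero_symm.mp h0)⟩⟩
  loopless := ⟨fun _ h => h.1 rfl⟩

/-- The index set of the connected components of the transition graph. -/
abbrev Component (B : BasisSet m d) : Type := (transitionGraph B).ConnectedComponent

noncomputable instance (B : BasisSet m d) : Fintype (Component B) := Fintype.ofFinite _

open Classical in
/-- The indices `k` of the states of the basis `x` that lie in the component `a`. -/
noncomputable def componentIndices (B : BasisSet m d) (x : Fin m) (a : Component B) :
    Finset (Fin d) :=
  Finset.univ.filter fun k => (transitionGraph B).connectedComponentMk (x, k) = a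

/-- The component projector `P_a`, computed from the basis `x`; it does not depend on `x`, see
`componentProj_eq`. -/
noncomputable def componentProj (B : BasisSet m d) (x : Fin m) (a : Component B) :
    Matrix (Fin d) (Fin d) ℂ :=
  ∑ k ∈ componentIndices B x a, basisProj B x k

/-- The component rank `r_a = tr P_a`, as a natural number; see `trace_componentProj`. -/
noncomputable def componentRank (B : BasisSet m d) (x : Fin m) (a : Component B) : ℕ :=
  (componentIndices B x a).card

/-- The minimum component rank. (There is a component as soon as `m` and `d` are positive.) -/
noncomputable def minComponentRank (B : BasisSet m d) (x : Fin m) : ℕ :=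
  ⨅ a : Component B, componentRank B x a

/-- `ρ` is a zero-uncertainty state: for each basis there is a POVM of Bob with which he guesses
Alice's outcome with probability one. -/
def IsZUS {n : ℕ} (B : BasisSet m d) (ρ : BiOp d n) : Prop :=
  IsState ρ ∧ ∀ x : Fin m, ∃ M : Fin d → Matrix (Fin n) (Fin n) ℂ,
    (∀ k, (M k).PosSemidef) ∧ ∑ k, M k = 1 ∧
      ∑ k, (ρ * (basisProj B x k ⊗ₖ M k)).trace = 1

/-- The component vector `q_a = tr (ρ (P_a ⊗ 1))`. -/
noncomputable def componentVector {n : ℕ} (B : BasisSet m d) (x : Fin m) (ρ : BiOp d n)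
    (a : Component B) : ℝ :=
  (ρ * (componentProj B x a ⊗ₖ (1 : Matrix (Fin n) (Fin n) ℂ))).trace.re

/-- `ρ_𝓑 = ∑ₐ (P_a ⊗ 1) ρ (P_a ⊗ 1)`. -/
noncomputable def decohere {n : ℕ} (B : BasisSet m d) (x : Fin m) (ρ : BiOp d n) : BiOp d n :=
  ∑ a : Component B, (componentProj B x a ⊗ₖ (1 : Matrix (Fin n) (Fin n) ℂ)) * ρ *
    (componentProj B x a ⊗ₖ (1 : Matrix (Fin n) (Fin n) ℂ))

/-! ### The component projectors are well defined -/

theorem basisProj_mul (B : BasisSet m d) (x y : Fin m) (k l : Fin d) :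
    basisProj B x k * basisProj B y l =
      inner ℂ (B x k) (B y l) • Matrix.vecMulVec (fun i => B x k i) (star fun i => B y l i) := by
  ext i j
  simp only [basisProj, ketBra, Matrix.mul_apply, Matrix.vecMulVec_apply, Matrix.smul_apply,
    PiLp.inner_apply, RCLike.inner_apply, smul_eq_mul, Finset.sum_mul, Pi.star_apply,
    RCLike.star_def]
  exact Finset.sum_congr rfl fun t _ => by ring

theorem sum_basisProj (B : BasisSet m d) (x : Fin m) : ∑ k, basisProj B x k = 1 := by
  ext i j
  have h := (B x).sum_inner_mul_inner (EuclideanSpace.single i (1 : ℂ))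
    (EuclideanSpace.single j (1 : ℂ))
  simpa [Matrix.sum_apply, basisProj, ketBra, Matrix.vecMulVec_apply, Matrix.one_apply,
    EuclideanSpace.inner_single_left, EuclideanSpace.inner_single_right, eq_comm] using h

theorem sum_componentProj (B : BasisSet m d) (x : Fin m) :
    ∑ a, componentProj B x a = 1 := by
  classical
  rw [← sum_basisProj B x]
  simp only [componentProj, componentIndices]
  convert Finset.sum_fiberwise (Finset.univ : Finset (Fin d))
    (fun k => (transitionGraph B).connectedComponentMk (x, k)) (fun k => basisProj B x k)

theorem componentProj_mul_of_ne (B : BasisSet m d) (x y : Fin m) {a b : Component B}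
    (hab : a ≠ b) : componentProj B x a * componentProj B y b = 0 := by
  simp only [componentProj, Finset.sum_mul_sum]
  refine Finset.sum_eq_zero fun k hk => Finset.sum_eq_zero fun l hl => ?_
  simp only [componentIndices, Finset.mem_filter, Finset.mem_univ, true_and] at hk hl
  rw [basisProj_mul]
  by_cases h0 : inner ℂ (B x k) (B y l) = 0
  · rw [h0, zero_smul]
  · exfalso
    apply hab
    rw [← hk, ← hl]
    by_cases hp : ((x, k) : Fin m × Fin d) = (y, l)
    · rw [hp]
    · exact SimpleGraph.ConnectedComponent.sound
        (SimpleGraph.Adj.reachable (G := transitionGraph B) ⟨hp, h0⟩)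

/-- The component projectors do not depend on the basis from which they are computed. -/
theorem componentProj_eq (B : BasisSet m d) (x y : Fin m) (a : Component B) :
    componentProj B x a = componentProj B y a := by
  have h1 : componentProj B x a = componentProj B x a * componentProj B y a := by
    conv_lhs => rw [← mul_one (componentProj B x a), ← sum_componentProj B y, Finset.mul_sum]
    exact Finset.sum_eq_single a
      (fun b _ hb => componentProj_mul_of_ne B x y (Ne.symm hb)) (by simp)
  have h2 : componentProj B y a = componentProj B x a * componentProj B y a := by
    conv_lhs => rw [← one_mul (componentProj B y a), ← sum_componentProj B x, Finset.sum_mul]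
    exact Finset.sum_eq_single a
      (fun b _ hb => componentProj_mul_of_ne B x y hb) (by simp)
  rw [h1, ← h2]

theorem trace_componentProj (B : BasisSet m d) (x : Fin m) (a : Component B) :
    (componentProj B x a).trace = componentRank B x a := by
  have h : ∀ k, (basisProj B x k).trace = 1 := fun k => by
    have h1 : inner ℂ (B x k) (B x k) = (1 : ℂ) := by simp
    rw [PiLp.inner_apply] at h1
    rw [← h1]
    simp [Matrix.trace, basisProj, ketBra, Matrix.vecMulVec_apply, Complex.mul_conj,
      Complex.normSq_eq_norm_sq]
  simp [componentProj, componentRank, Matrix.trace_sum, h]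

end ZeroUncertainty

open ZeroUncertainty

/-! A vector of `ℂ^m ⊗ ℂ^n` is treated as its coefficient matrix T, so that A ⊗ C sends T to A T Cᵀ.
Perfect guessing means that every wrong pair (k, l) has probability zero, and by positivity
(|ψ_xk⟩⟨ψ_xk| ⊗ M_l) ρ = 0 for k ≠ l (`IsZUS.exists_mul_eq_zero`). These relations survive
compression to a component a.

Let T_i be the eigenvectors, with nonzero eigenvalues p_i, of the normalized block τ_a. The
relations make every T_i T_j* diagonal in all the bases. Its diagonal entries agree along the edges
of the transition graph, so it is scalar on each component (`exists_mul_componentProj_eq_smul`).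
Orthonormality fixes the scalar: T_i T_j* = δ_ij P_a / r_a. For i = j this says that each
eigenvector is maximally entangled of rank r_a; for i ≠ j, that Bob's supports are orthogonal. Bob
can therefore learn i without disturbance, whence E(τ_a) ≥ E(Φ(r_a)), and convexity gives the
converse (`IsEntanglementMonotone.component_bounds`).

Alice's measurement of (P_a) does the rest: with the outcome forgotten it turns ρ into ρ_𝓑, and with
the outcome kept it turns ρ_𝓑 into the τ_a with weights q_a. The last inequality holds because
E(Φ(r)) does not decrease with r (`IsEntanglementMonotone.le_of_isPureMES_of_le`). -/

namespace ZeroUncertainty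

/-! ### Vectors of `ℂ^m ⊗ ℂ^n` as matrices -/

/-- The vector of `ℂ^m ⊗ ℂ^n` with coefficient matrix `T`. -/
def ket {m n : ℕ} (T : Matrix (Fin m) (Fin n) ℂ) : Fin m × Fin n → ℂ := fun p => T p.1 p.2

/-- Bob's operator enters transposed, not adjoint; this is the source of the transposes below. -/
theorem kronecker_mulVec_ket {m n m' n' : ℕ} (A : Matrix (Fin m') (Fin m) ℂ)
    (B : Matrix (Fin n') (Fin n) ℂ) (T : Matrix (Fin m) (Fin n) ℂ) :
    (A ⊗ₖ B).mulVec (ket T) = ket (A * T * B.transpose) := by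
  ext ⟨i, j⟩
  simp only [Matrix.mulVec, dotProduct, ket, Matrix.kroneckerMap_apply, Matrix.mul_apply,
    Matrix.transpose_apply, Fintype.sum_prod_type, Finset.sum_mul]
  rw [Finset.sum_comm]
  exact Finset.sum_congr rfl fun _ _ => Finset.sum_congr rfl fun _ _ => by ring

theorem conj_ketBra {ι κ : Type} [Fintype ι] [Fintype κ] (A : Matrix κ ι ℂ) (ψ : ι → ℂ) :
    A * ketBra ψ * A.conjTranspose = ketBra (A.mulVec ψ) := by
  rw [ketBra, ketBra, Matrix.mul_vecMulVec, Matrix.vecMulVec_mul, Matrix.star_mulVec]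

theorem ketBra_smul {ι : Type} (c : ℂ) (ψ : ι → ℂ) :
    ketBra (c • ψ) = (c * star c) • ketBra ψ := by
  ext i j
  simp [ketBra, Matrix.vecMulVec_apply]
  ring

theorem posSemidef_ketBra {ι : Type} [Fintype ι] (ψ : ι → ℂ) : (ketBra ψ).PosSemidef :=
  Matrix.posSemidef_vecMulVec_self_star ψ

theorem trace_ketBra_ket {m n : ℕ} (T : Matrix (Fin m) (Fin n) ℂ) :
    (ketBra (ket T)).trace = (T * T.conjTranspose).trace := by
  simp [ketBra, ket, Matrix.trace, Matrix.vecMulVec_apply, Matrix.mul_apply,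
    Fintype.sum_prod_type]

theorem ket_injective {m n : ℕ} : Function.Injective (ket (m := m) (n := n)) := fun S T h => by
  ext i j
  exact congrFun h (i, j)

theorem ket_smul {m n : ℕ} (c : ℂ) (T : Matrix (Fin m) (Fin n) ℂ) : ket (c • T) = c • ket T := rfl

/-! ### Pure maximally entangled states -/

/-- The pure maximally entangled state of two isometries `U`, `V`. -/
noncomputable def mes {r m n : ℕ} (U : Matrix (Fin m) (Fin r) ℂ) (V : Matrix (Fin n) (Fin r) ℂ) :
    BiOp m n :=
  ketBra (ket (((√(r : ℝ) : ℝ) : ℂ)⁻¹ • (U * V.transpose)))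

theorem orthonormal_iff_conjTranspose_mul_self {r m : ℕ}
    (u : Fin r → EuclideanSpace ℂ (Fin m)) :
    Orthonormal ℂ u ↔
      (Matrix.of fun i l => u l i).conjTranspose * (Matrix.of fun i l => u l i) = 1 := by
  rw [orthonormal_iff_ite, ← Matrix.ext_iff]
  refine forall_congr' fun l => forall_congr' fun l' => ?_
  simp only [PiLp.inner_apply, RCLike.inner_apply, Matrix.mul_apply, Matrix.conjTranspose_apply,
    Matrix.of_apply, Matrix.one_apply, RCLike.star_def, mul_comm]

theorem isPureMES_iff {r m n : ℕ} (σ : BiOp m n) :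
    IsPureMES r σ ↔ ∃ (U : Matrix (Fin m) (Fin r) ℂ) (V : Matrix (Fin n) (Fin r) ℂ),
      U.conjTranspose * U = 1 ∧ V.conjTranspose * V = 1 ∧ σ = mes U V := by
  constructor
  · rintro ⟨u, v, hu, hv, rfl⟩
    refine ⟨_, _, (orthonormal_iff_conjTranspose_mul_self u).1 hu,
      (orthonormal_iff_conjTranspose_mul_self v).1 hv, ?_⟩
    rfl
  · rintro ⟨U, V, hU, hV, rfl⟩
    refine ⟨fun l => WithLp.toLp 2 fun i => U i l, fun l => WithLp.toLp 2 fun i => V i l,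
      (orthonormal_iff_conjTranspose_mul_self _).2 hU,
      (orthonormal_iff_conjTranspose_mul_self _).2 hV, ?_⟩
    rfl

theorem isPureMES_mes {r m n : ℕ} {U : Matrix (Fin m) (Fin r) ℂ} {V : Matrix (Fin n) (Fin r) ℂ}
    (hU : U.conjTranspose * U = 1) (hV : V.conjTranspose * V = 1) : IsPureMES r (mes U V) :=
  (isPureMES_iff _).2 ⟨U, V, hU, hV, rfl⟩

theorem ofReal_sqrt_inv_mul_star (r : ℕ) :
    ((√(r : ℝ) : ℝ) : ℂ)⁻¹ * star ((√(r : ℝ) : ℝ) : ℂ)⁻¹ = (r : ℂ)⁻¹ := by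
  rw [star_inv₀, RCLike.star_def, Complex.conj_ofReal, ← mul_inv, ← Complex.ofReal_mul,
    Real.mul_self_sqrt (Nat.cast_nonneg r), Complex.ofReal_natCast]

theorem transpose_mul_conjTranspose_transpose {r n : ℕ} {V : Matrix (Fin n) (Fin r) ℂ}
    (hV : V.conjTranspose * V = 1) : V.transpose * V.transpose.conjTranspose = 1 := by
  have h := congrArg Matrix.transpose hV
  rwa [Matrix.transpose_mul, Matrix.transpose_one] at h

theorem isState_mes {r m n : ℕ} (hr : 0 < r) {U : Matrix (Fin m) (Fin r) ℂ}
    {V : Matrix (Fin n) (Fin r) ℂ} (hU : U.conjTranspose * U = 1)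
    (hV : V.conjTranspose * V = 1) : IsState (mes U V) := by
  refine ⟨posSemidef_ketBra _, ?_⟩
  rw [mes, ket_smul, ketBra_smul, Matrix.trace_smul, trace_ketBra_ket, ofReal_sqrt_inv_mul_star,
    Matrix.conjTranspose_mul, Matrix.mul_assoc, ← Matrix.mul_assoc V.transpose,
    transpose_mul_conjTranspose_transpose hV, Matrix.one_mul, Matrix.trace_mul_comm, hU,
    Matrix.trace_one, Fintype.card_fin, smul_eq_mul]
  exact inv_mul_cancel₀ (Nat.cast_ne_zero.2 hr.ne')

/-! ### Monotonicity under local measurements -/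

/-- The effect on `ρ` of Alice's Kraus operator `K`. -/
noncomputable def aliceConj {m n d : ℕ} (K : Matrix (Fin d) (Fin m) ℂ) (ρ : BiOp m n) : BiOp d n :=
  (K ⊗ₖ (1 : Matrix (Fin n) (Fin n) ℂ)) * ρ * (K ⊗ₖ (1 : Matrix (Fin n) (Fin n) ℂ)).conjTranspose

/-- The effect on `ρ` of Bob's Kraus operator `K`. -/
noncomputable def bobConj {m n d : ℕ} (K : Matrix (Fin d) (Fin n) ℂ) (ρ : BiOp m n) : BiOp m d :=
  ((1 : Matrix (Fin m) (Fin m) ℂ) ⊗ₖ K) * ρ * ((1 : Matrix (Fin m) (Fin m) ℂ) ⊗ₖ K).conjTranspose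

theorem aliceConj_ketBra {m n d : ℕ} (K : Matrix (Fin d) (Fin m) ℂ)
    (T : Matrix (Fin m) (Fin n) ℂ) :
    aliceConj K (ketBra (ket T)) = ketBra (ket (K * T)) := by
  rw [aliceConj, conj_ketBra, kronecker_mulVec_ket, Matrix.transpose_one, Matrix.mul_one]

theorem bobConj_ketBra {m n d : ℕ} (K : Matrix (Fin d) (Fin n) ℂ)
    (T : Matrix (Fin m) (Fin n) ℂ) :
    bobConj K (ketBra (ket T)) = ketBra (ket (T * K.transpose)) := by
  rw [bobConj, conj_ketBra, kronecker_mulVec_ket, Matrix.one_mul]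

/-- An outcome of probability zero has a meaningless normalized state, but its weight removes it;
hence `σ` is unconstrained when `p = 0`. -/
theorem prob_mul_post_eq {m n m' n' s : ℕ} (E : ∀ m n : ℕ, BiOp m n → ℝ)
    (P : LOCC (Fin s) m' n' m n) (ρ : BiOp m n) (o : Fin s) {p : ℝ} {σ : BiOp m' n'}
    (h : P.run ρ o = p • σ) (hσ : p ≠ 0 → σ.trace = 1) :
    P.prob ρ o * E m' n' (P.post ρ o) = p * E m' n' σ := by
  by_cases hp : p = 0
  · simp [LOCC.prob, h, hp]
  · have h1 : P.prob ρ o = p := by simp [LOCC.prob, h, hσ hp, Matrix.trace_smul]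
    rw [LOCC.post, h1, h, smul_smul, inv_mul_cancel₀ hp, one_smul]

/-- One round in which every outcome is its own label. The free index type allows components and
`Option` families. -/
theorem IsEntanglementMonotone.alice_selective {E : ∀ m n : ℕ, BiOp m n → ℝ}
    (hE : IsEntanglementMonotone E) {m n d : ℕ} {ι : Type} [Fintype ι] {ρ : BiOp m n}
    (hρ : IsState ρ) (K : ι → Matrix (Fin d) (Fin m) ℂ)
    (hK : ∑ i, (K i).conjTranspose * K i = 1) (p : ι → ℝ) (σ : ι → BiOp d n)
    (h : ∀ i, aliceConj (K i) ρ = p i • σ i) (hσ : ∀ i, p i ≠ 0 → (σ i).trace = 1) :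
    ∑ i, p i * E d n (σ i) ≤ E m n ρ := by
  let e := (Fintype.equivFin ι).symm
  have hK' : ∑ i, (K (e i)).conjTranspose * K (e i) = 1 := by
    rw [← hK]
    exact e.sum_comp fun i => (K i).conjTranspose * K i
  refine le_of_eq_of_le ?_ (hE m n d n _ (.alice _ d (fun i => K (e i)) hK' .done) ρ hρ)
  rw [← e.sum_comp]
  refine Finset.sum_congr rfl fun o _ => (prob_mul_post_eq E _ ρ o ?_ (hσ (e o))).symm
  simpa [LOCC.run, aliceConj, bobConj] using h (e o)

theorem IsEntanglementMonotone.bob_selective {E : ∀ m n : ℕ, BiOp m n → ℝ}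
    (hE : IsEntanglementMonotone E) {m n d : ℕ} {ι : Type} [Fintype ι] {ρ : BiOp m n}
    (hρ : IsState ρ) (K : ι → Matrix (Fin d) (Fin n) ℂ)
    (hK : ∑ i, (K i).conjTranspose * K i = 1) (p : ι → ℝ) (σ : ι → BiOp m d)
    (h : ∀ i, bobConj (K i) ρ = p i • σ i) (hσ : ∀ i, p i ≠ 0 → (σ i).trace = 1) :
    ∑ i, p i * E m d (σ i) ≤ E m n ρ := by
  let e := (Fintype.equivFin ι).symm
  have hK' : ∑ i, (K (e i)).conjTranspose * K (e i) = 1 := by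
    rw [← hK]
    exact e.sum_comp fun i => (K i).conjTranspose * K i
  refine le_of_eq_of_le ?_ (hE m n m d _ (.bob _ d (fun i => K (e i)) hK' .done) ρ hρ)
  rw [← e.sum_comp]
  refine Finset.sum_congr rfl fun o _ => (prob_mul_post_eq E _ ρ o ?_ (hσ (e o))).symm
  simpa [LOCC.run, aliceConj, bobConj] using h (e o)

/-- All branches announce the same label, so the outcome is forgotten. -/
theorem IsEntanglementMonotone.alice_nonselective {E : ∀ m n : ℕ, BiOp m n → ℝ}
    (hE : IsEntanglementMonotone E) {m n d : ℕ} {ι : Type} [Fintype ι] {ρ : BiOp m n}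
    (hρ : IsState ρ) (K : ι → Matrix (Fin d) (Fin m) ℂ)
    (hK : ∑ i, (K i).conjTranspose * K i = 1) {σ : BiOp d n}
    (h : ∑ i, aliceConj (K i) ρ = σ) (hσ : σ.trace = 1) :
    E d n σ ≤ E m n ρ := by
  let e := (Fintype.equivFin ι).symm
  have hK' : ∑ i, (K (e i)).conjTranspose * K (e i) = 1 := by
    rw [← hK]
    exact e.sum_comp fun i => (K i).conjTranspose * K i
  refine le_of_eq_of_le ?_
    (hE m n d n 1 (.alice _ d (fun i => K (e i)) hK' fun _ => .done 0) ρ hρ)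
  rw [Fin.sum_univ_one, prob_mul_post_eq E _ ρ 0 (p := 1) (σ := σ) _ fun _ => hσ, one_mul]
  rw [one_smul, ← h]
  simpa [LOCC.run] using! e.sum_comp fun i => aliceConj (K i) ρ

/-! ### Values at pure maximally entangled states -/

/-- A partial isometry taking the isometry `U` to the isometry `U'`, completed to a measurement. -/
theorem exists_kraus_mul_eq {r m m' : ℕ} (hr : 0 < r) {U : Matrix (Fin m) (Fin r) ℂ}
    {U' : Matrix (Fin m') (Fin r) ℂ} (hU : U.conjTranspose * U = 1)
    (hU' : U'.conjTranspose * U' = 1) :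
    ∃ K : Option (Fin m) → Matrix (Fin m') (Fin m) ℂ,
      ∑ i, (K i).conjTranspose * K i = 1 ∧ K none * U = U' ∧ ∀ i, K (some i) * U = 0 := by
  have hm' : 0 < m' := by
    rcases Nat.eq_zero_or_pos m' with rfl | h
    · have h1 := congrFun (congrFun hU' ⟨0, hr⟩) ⟨0, hr⟩
      simp [Matrix.mul_apply] at h1
    · exact h
  set Q : Matrix (Fin m) (Fin m) ℂ := 1 - U * U.conjTranspose with hQ
  have hQh : Q.conjTranspose = Q := by simp [hQ]
  have hQU : Q * U = 0 := by rw [hQ, Matrix.sub_mul, Matrix.mul_assoc, hU]; simp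
  have hQQ : Q * Q = Q := by
    conv_lhs => rw [hQ, Matrix.mul_sub, ← Matrix.mul_assoc, ← hQ, hQU]
    simp
  -- `Q` itself does not map into `ℂ^m'`, which may be smaller. It is split along the coordinates
  -- `i`, each sent to one fixed target vector; that vector exists because `r > 0`.
  refine ⟨fun o => o.elim (U' * U.conjTranspose) fun i => Matrix.single (⟨0, hm'⟩ : Fin m') i (1 : ℂ) * Q,
    ?_, ?_, ?_⟩
  · have h1 : ∀ i : Fin m, (Matrix.single (⟨0, hm'⟩ : Fin m') i (1 : ℂ) * Q).conjTranspose *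
        (Matrix.single (⟨0, hm'⟩ : Fin m') i (1 : ℂ) * Q) = Q * Matrix.single i i 1 * Q := by
      intro i
      rw [Matrix.conjTranspose_mul, hQh, Matrix.conjTranspose_single, Matrix.mul_assoc,
        ← Matrix.mul_assoc (Matrix.single _ _ _), Matrix.single_mul_single_same, Matrix.mul_assoc]
      simp
    have h2 : ∑ i : Fin m, Matrix.single i i (1 : ℂ) = 1 := by
      ext a b
      simp [Matrix.sum_apply, Matrix.single_apply, Matrix.one_apply, ite_and]
    rw [Fintype.sum_option]
    simp only [Option.elim, h1]
    rw [← Finset.sum_mul, ← Finset.mul_sum, h2, Matrix.mul_one, hQQ, Matrix.conjTranspose_mul,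
      Matrix.conjTranspose_conjTranspose, Matrix.mul_assoc, ← Matrix.mul_assoc _ U', hU',
      Matrix.one_mul, hQ]
    simp
  · simp [Matrix.mul_assoc, hU]
  · intro i
    simp [Matrix.mul_assoc, hQU]

theorem ketBra_ket_zero {m n : ℕ} : ketBra (ket (0 : Matrix (Fin m) (Fin n) ℂ)) = 0 := by
  ext
  simp [ketBra, ket, Matrix.vecMulVec_apply]

/-- Alice replaces `U` by `U'`, then Bob replaces `V` by `V'`; the outcome `none` is certain each
time. Used in both directions, this makes the value of E depend on `r` only. -/
theorem IsEntanglementMonotone.le_of_isPureMES {E : ∀ m n : ℕ, BiOp m n → ℝ}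
    (hE : IsEntanglementMonotone E) {r m n m' n' : ℕ} (hr : 0 < r) {σ : BiOp m n}
    {σ' : BiOp m' n'} (h : IsPureMES r σ) (h' : IsPureMES r σ') : E m' n' σ' ≤ E m n σ := by
  obtain ⟨U, V, hU, hV, rfl⟩ := (isPureMES_iff σ).1 h
  obtain ⟨U', V', hU', hV', rfl⟩ := (isPureMES_iff σ').1 h'
  obtain ⟨K, hK, hK0, hK1⟩ := exists_kraus_mul_eq hr hU hU'
  obtain ⟨L, hL, hL0, hL1⟩ := exists_kraus_mul_eq hr hV hV'
  have hA := hE.alice_selective (isState_mes hr hU hV) K hK (fun o => o.elim 1 fun _ => 0)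
    (fun _ => mes U' V)
    (by
      rintro (_ | i)
      · simp [mes, aliceConj_ketBra, ← Matrix.mul_assoc, hK0]
      · simp [mes, aliceConj_ketBra, ← Matrix.mul_assoc, hK1, ketBra_ket_zero])
    fun _ _ => (isState_mes hr hU' hV).2
  have hB := hE.bob_selective (isState_mes hr hU' hV) L hL (fun o => o.elim 1 fun _ => 0)
    (fun _ => mes U' V')
    (by
      rintro (_ | i)
      · simp [mes, bobConj_ketBra, Matrix.mul_assoc, ← Matrix.transpose_mul, hL0]
      · simp [mes, bobConj_ketBra, Matrix.mul_assoc, ← Matrix.transpose_mul, hL1,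
          ketBra_ket_zero])
    fun _ _ => (isState_mes hr hU' hV').2
  simp only [Fintype.sum_option, Option.elim, one_mul, zero_mul, Finset.sum_const_zero,
    add_zero] at hA hB
  exact hB.trans hA

theorem IsEntanglementMonotone.eq_of_isPureMES {E : ∀ m n : ℕ, BiOp m n → ℝ}
    (hE : IsEntanglementMonotone E) {r m n m' n' : ℕ} (hr : 0 < r) {σ : BiOp m n}
    {σ' : BiOp m' n'} (h : IsPureMES r σ) (h' : IsPureMES r σ') : E m n σ = E m' n' σ' :=
  le_antisymm (hE.le_of_isPureMES hr h' h) (hE.le_of_isPureMES hr h h')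

theorem isPureMES_mes_one (r : ℕ) :
    IsPureMES r (mes (1 : Matrix (Fin r) (Fin r) ℂ) (1 : Matrix (Fin r) (Fin r) ℂ)) :=
  isPureMES_mes (by simp) (by simp)

/-- Alice can lower the Schmidt rank by one: she deletes a random Schmidt vector. -/
theorem IsEntanglementMonotone.mes_one_le_succ {E : ∀ m n : ℕ, BiOp m n → ℝ}
    (hE : IsEntanglementMonotone E) {r : ℕ} (hr : 0 < r) :
    E r r (mes (1 : Matrix (Fin r) (Fin r) ℂ) 1) ≤
      E (r + 1) (r + 1) (mes (1 : Matrix (Fin (r + 1)) (Fin (r + 1)) ℂ) 1) := by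
  have hr0 : (r : ℂ) ≠ 0 := Nat.cast_ne_zero.2 hr.ne'
  -- `S i` includes the coordinates other than `i`, so `S i * (S i)ᵀ` deletes coordinate `i`.
  let S : Fin (r + 1) → Matrix (Fin (r + 1)) (Fin r) ℂ := fun i =>
    (1 : Matrix (Fin (r + 1)) (Fin (r + 1)) ℂ).submatrix id i.succAbove
  have hS : ∀ i, (S i).conjTranspose * S i = 1 := by
    intro i
    ext a b
    simp [S, Matrix.mul_apply, Matrix.one_apply]
  have hSS : ∀ i, S i * (S i).transpose = 1 - Matrix.single i i 1 := by
    intro i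
    ext a b
    have h := Fin.sum_univ_succAbove (fun l => (1 : Matrix (Fin (r + 1)) (Fin (r + 1)) ℂ) a l *
      (1 : Matrix (Fin (r + 1)) (Fin (r + 1)) ℂ) b l) i
    have h1 : ∑ l, (1 : Matrix (Fin (r + 1)) (Fin (r + 1)) ℂ) a l *
      (1 : Matrix (Fin (r + 1)) (Fin (r + 1)) ℂ) b l =
        (1 : Matrix (Fin (r + 1)) (Fin (r + 1)) ℂ) a b := by
      simp [Matrix.one_apply]
    rw [Matrix.sub_apply, ← h1, h, Matrix.mul_apply]
    have h2 : Matrix.single i i (1 : ℂ) a b = (1 : Matrix (Fin (r + 1)) (Fin (r + 1)) ℂ) a i *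
      (1 : Matrix (Fin (r + 1)) (Fin (r + 1)) ℂ) b i := by
      simp [Matrix.single_apply, Matrix.one_apply, eq_comm, ite_and]
      split_ifs <;> simp_all
    rw [h2]
    exact (add_sub_cancel_left _ _).symm
  have hSh : ∀ i, (S i).transpose = (S i).conjTranspose := by
    intro i
    ext a b
    simp [S, Matrix.one_apply, apply_ite]
  have hP : ∀ i, (1 - Matrix.single i i 1 : Matrix (Fin (r + 1)) (Fin (r + 1)) ℂ).conjTranspose *
      (1 - Matrix.single i i 1) = 1 - Matrix.single i i 1 := by
    intro i
    rw [← hSS, hSh, Matrix.conjTranspose_mul, Matrix.conjTranspose_conjTranspose,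
      Matrix.mul_assoc, ← Matrix.mul_assoc _ (S i), hS, Matrix.one_mul]
  have hsum : ∑ i : Fin (r + 1), Matrix.single i i (1 : ℂ) = 1 := by
    ext a b
    simp [Matrix.sum_apply, Matrix.single_apply, Matrix.one_apply, ite_and]
  have key := hE.alice_selective
    (isState_mes (U := (1 : Matrix (Fin (r + 1)) (Fin (r + 1)) ℂ))
      (V := (1 : Matrix (Fin (r + 1)) (Fin (r + 1)) ℂ)) r.succ_pos (by simp) (by simp))
    -- Each coordinate survives in `r` of the `r + 1` deletions, so the projectors sum to `r • 1`;
    -- hence the factor r^(-1/2).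
    (fun i : Fin (r + 1) => ((√(r : ℝ) : ℝ) : ℂ)⁻¹ • (1 - Matrix.single i i 1))
    (by
      simp only [Matrix.conjTranspose_smul, Matrix.smul_mul, Matrix.mul_smul, smul_smul, hP]
      rw [← Finset.smul_sum, ofReal_sqrt_inv_mul_star, Finset.sum_sub_distrib, hsum,
        Finset.sum_const, Finset.card_univ, Fintype.card_fin, succ_nsmul, add_sub_cancel_right,
        ← Nat.cast_smul_eq_nsmul ℂ, smul_smul, inv_mul_cancel₀ hr0, one_smul])
    -- Deleting on Alice's side alone leaves a multiple of `S i * (S i)ᵀ`, so Bob's Schmidt vector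
    -- disappears as well.
    (fun _ => ((r + 1 : ℕ) : ℝ)⁻¹) (fun i => mes (S i) (S i))
    (by
      intro i
      rw [mes, aliceConj_ketBra, mes, ← hSS, Matrix.transpose_one, Matrix.mul_one,
        Matrix.mul_smul, Matrix.mul_one, ket_smul, ketBra_smul, ofReal_sqrt_inv_mul_star]
      ext a b
      simp [Matrix.smul_apply])
    fun i _ => (isState_mes hr (hS i) (hS i)).2
  have hc : ∀ i, E (r + 1) (r + 1) (mes (S i) (S i)) =
      E r r (mes (1 : Matrix (Fin r) (Fin r) ℂ) 1) := fun i =>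
    hE.eq_of_isPureMES hr (isPureMES_mes (hS i) (hS i)) (isPureMES_mes_one r)
  simp only [hc, Finset.sum_const, Finset.card_univ, Fintype.card_fin, nsmul_eq_mul] at key
  rwa [← mul_assoc, mul_inv_cancel₀ (Nat.cast_ne_zero.2 r.succ_ne_zero), one_mul] at key

theorem IsEntanglementMonotone.le_of_isPureMES_of_le {E : ∀ m n : ℕ, BiOp m n → ℝ}
    (hE : IsEntanglementMonotone E) {r s m n m' n' : ℕ} (hs : 0 < s) (hsr : s ≤ r)
    {σ : BiOp m n} {σ' : BiOp m' n'} (h : IsPureMES r σ) (h' : IsPureMES s σ') :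
    E m' n' σ' ≤ E m n σ := by
  rw [hE.eq_of_isPureMES hs h' (isPureMES_mes_one s),
    hE.eq_of_isPureMES (hs.trans_le hsr) h (isPureMES_mes_one r)]
  clear h h'
  induction r, hsr using Nat.le_induction with
  | base => exact le_rfl
  | succ r hr ih => exact ih.trans (hE.mes_one_le_succ (hs.trans_le hr))

/-! ### Positive semidefinite operators -/

open scoped MatrixOrder in
theorem exists_eq_conjTranspose_mul_self {ι : Type} [Fintype ι] {A : Matrix ι ι ℂ}
    (hA : A.PosSemidef) : ∃ R : Matrix ι ι ℂ, A = R.conjTranspose * R := by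
  classical
  exact CStarAlgebra.nonneg_iff_eq_star_mul_self.mp hA.nonneg

/-- The right side is a squared Hilbert–Schmidt norm. This yields both the nonnegativity of tr(AC)
and the vanishing of AC when the trace is zero. -/
theorem trace_mul_eq_trace_conjTranspose_mul_self {ι : Type} [Fintype ι] (R S : Matrix ι ι ℂ) :
    (R.conjTranspose * R * (S.conjTranspose * S)).trace =
      ((R * S.conjTranspose).conjTranspose * (R * S.conjTranspose)).trace := by
  rw [Matrix.conjTranspose_mul, Matrix.conjTranspose_conjTranspose, ← Matrix.mul_assoc,
    Matrix.trace_mul_comm]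
  simp only [Matrix.mul_assoc]

theorem trace_mul_nonneg_of_posSemidef {ι : Type} [Fintype ι] {A C : Matrix ι ι ℂ}
    (hA : A.PosSemidef) (hC : C.PosSemidef) : 0 ≤ (A * C).trace := by
  obtain ⟨R, rfl⟩ := exists_eq_conjTranspose_mul_self hA
  obtain ⟨S, rfl⟩ := exists_eq_conjTranspose_mul_self hC
  rw [trace_mul_eq_trace_conjTranspose_mul_self]
  exact (Matrix.posSemidef_conjTranspose_mul_self _).trace_nonneg

theorem mul_eq_zero_of_trace_mul_eq_zero {ι : Type} [Fintype ι] {A C : Matrix ι ι ℂ}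
    (hA : A.PosSemidef) (hC : C.PosSemidef) (h : (A * C).trace = 0) : A * C = 0 := by
  obtain ⟨R, rfl⟩ := exists_eq_conjTranspose_mul_self hA
  obtain ⟨S, rfl⟩ := exists_eq_conjTranspose_mul_self hC
  rw [trace_mul_eq_trace_conjTranspose_mul_self,
    Matrix.trace_conjTranspose_mul_self_eq_zero_iff] at h
  rw [Matrix.mul_assoc, ← Matrix.mul_assoc R, h, Matrix.zero_mul, Matrix.mul_zero]

theorem sum_ketBra_orthonormalBasis {ι : Type} [Fintype ι] [DecidableEq ι]
    (e : OrthonormalBasis ι ℂ (EuclideanSpace ℂ ι)) :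
    ∑ k, ketBra (fun i => e k i) = 1 := by
  ext i j
  have h := e.sum_inner_mul_inner (EuclideanSpace.single i (1 : ℂ))
    (EuclideanSpace.single j (1 : ℂ))
  simpa [Matrix.sum_apply, ketBra, Matrix.vecMulVec_apply, Matrix.one_apply,
    EuclideanSpace.inner_single_left, EuclideanSpace.inner_single_right, eq_comm] using h

/-- The spectral decomposition of a positive operator on `ℂ^m ⊗ ℂ^n`, with eigenvectors written as
matrices. -/
theorem exists_ket_decomposition {m n : ℕ} {τ : BiOp m n} (hτ : τ.PosSemidef) :
    ∃ (p : Fin m × Fin n → ℝ) (T : Fin m × Fin n → Matrix (Fin m) (Fin n) ℂ),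
      (∀ i, 0 ≤ p i) ∧ τ = ∑ i, p i • ketBra (ket (T i)) ∧
      (∀ i, τ.mulVec (ket (T i)) = p i • ket (T i)) ∧
      ∀ i j, (T i * (T j).conjTranspose).trace = if i = j then 1 else 0 := by
  let e := hτ.1.eigenvectorBasis
  have hvec : ∀ i, τ.mulVec (ket (Matrix.of fun a b => e i (a, b))) =
      hτ.1.eigenvalues i • ket (Matrix.of fun a b => e i (a, b)) :=
    hτ.1.mulVec_eigenvectorBasis
  refine ⟨hτ.1.eigenvalues, fun i => Matrix.of fun a b => e i (a, b), hτ.eigenvalues_nonneg, ?_,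
    hvec, ?_⟩
  · have h1 : ∑ i, ketBra (ket (Matrix.of fun a b => e i (a, b))) = 1 :=
      sum_ketBra_orthonormalBasis e
    conv_lhs => rw [← Matrix.mul_one τ, ← h1, Finset.mul_sum]
    refine Finset.sum_congr rfl fun i _ => ?_
    rw [ketBra, Matrix.mul_vecMulVec, hvec, Matrix.smul_vecMulVec]
  · intro i j
    -- The inner product is conjugate-linear in its first argument, so tr(T_i T_j*) is ⟨e_j, e_i⟩.
    have h := orthonormal_iff_ite.1 e.orthonormal j i
    simp only [eq_comm (a := j)] at h
    rw [← h]
    simp [Matrix.trace, Matrix.mul_apply, PiLp.inner_apply, Fintype.sum_prod_type]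

/-! ### Components -/

variable {m d : ℕ}

theorem basisProj_conjTranspose (B : BasisSet m d) (x : Fin m) (k : Fin d) :
    (basisProj B x k).conjTranspose = basisProj B x k :=
  (posSemidef_ketBra _).1

theorem basisProj_mul_of_ne (B : BasisSet m d) (x : Fin m) {k l : Fin d} (h : k ≠ l) :
    basisProj B x k * basisProj B x l = 0 := by
  rw [basisProj_mul, (B x).orthonormal.2 h, zero_smul]

theorem basisProj_mul_self (B : BasisSet m d) (x : Fin m) (k : Fin d) :
    basisProj B x k * basisProj B x k = basisProj B x k := by
  rw [basisProj_mul, orthonormal_iff_ite.1 (B x).orthonormal, if_pos rfl, one_smul]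
  rfl

theorem vecMulVec_basis_ne_zero (B : BasisSet m d) (x y : Fin m) (k l : Fin d) :
    Matrix.vecMulVec (fun i => B x k i) (star fun i => B y l i) ≠ 0 := by
  intro h
  rw [Matrix.vecMulVec_eq_zero] at h
  rcases h with h | h
  · exact (B x).orthonormal.ne_zero k (by ext i; exact congrFun h i)
  · rw [star_eq_zero] at h
    exact (B y).orthonormal.ne_zero l (by ext i; exact congrFun h i)

theorem ketBra_mul_mul_ketBra {ι : Type} [Fintype ι] (ψ : ι → ℂ) (C : Matrix ι ι ℂ) :
    ketBra ψ * C * ketBra ψ = (star ψ ⬝ᵥ C.mulVec ψ) • ketBra ψ := by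
  rw [ketBra, Matrix.mul_assoc, Matrix.mul_vecMulVec, Matrix.vecMulVec_mul_vecMulVec]
  ext i j
  simp only [Matrix.vecMulVec_apply, Matrix.smul_apply, Pi.smul_apply, smul_eq_mul]
  ring

/-- An operator that is diagonal in every basis is scalar on every component. -/
theorem exists_mul_componentProj_eq_smul (B : BasisSet m d) (C : Matrix (Fin d) (Fin d) ℂ)
    (hC : ∀ x k l, k ≠ l → basisProj B x k * C * basisProj B x l = 0) :
    ∃ c : Component B → ℂ, ∀ x a, C * componentProj B x a = c a • componentProj B x a := by
  let f : Fin m × Fin d → ℂ := fun v =>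
    star (fun i => B v.1 v.2 i) ⬝ᵥ C.mulVec (fun i => B v.1 v.2 i)
  have hd : ∀ x k, basisProj B x k * C * basisProj B x k = f (x, k) • basisProj B x k :=
    fun x k => ketBra_mul_mul_ketBra _ _
  have hr : ∀ x k, C * basisProj B x k = f (x, k) • basisProj B x k := by
    intro x k
    rw [← hd, ← Matrix.one_mul (C * _), ← sum_basisProj B x, Finset.sum_mul]
    rw [Finset.sum_eq_single k, Matrix.mul_assoc]
    · intro l _ hl
      rw [← Matrix.mul_assoc, hC x l k hl]
    · simp
  have hl : ∀ x k, basisProj B x k * C = f (x, k) • basisProj B x k := by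
    intro x k
    rw [← hd]
    conv_lhs => rw [← Matrix.mul_one (_ * C), ← sum_basisProj B x, Finset.mul_sum]
    rw [Finset.sum_eq_single k]
    · intro l _ hl
      rw [hC x k l hl.symm]
    · simp
  have hadj : ∀ v w, (transitionGraph B).Adj v w → f v = f w := by
    rintro ⟨x, k⟩ ⟨y, l⟩ ⟨-, h⟩
    -- `C` between the two projectors may be absorbed on either side; the product of the projectors
    -- is nonzero on an edge, so the two scalars agree.
    have h1 : f (x, k) • (basisProj B x k * basisProj B y l) =
        f (y, l) • (basisProj B x k * basisProj B y l) := by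
      rw [← Matrix.smul_mul, ← hl, Matrix.mul_assoc, hr, Matrix.mul_smul]
    refine smul_left_injective ℂ (?_ : basisProj B x k * basisProj B y l ≠ 0) h1
    rw [basisProj_mul]
    exact smul_ne_zero h (vecMulVec_basis_ne_zero B x y k l)
  have hwalk : ∀ v w (_ : (transitionGraph B).Walk v w), f v = f w := by
    intro v w q
    induction q with
    | nil => rfl
    | cons h _ ih => exact (hadj _ _ h).trans ih
  refine ⟨SimpleGraph.ConnectedComponent.lift f fun v w q _ => hwalk v w q, fun x a => ?_⟩
  rw [componentProj, Finset.mul_sum, Finset.smul_sum]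
  refine Finset.sum_congr rfl fun k hk => ?_
  simp only [componentIndices, Finset.mem_filter, Finset.mem_univ, true_and] at hk
  rw [hr, ← hk, SimpleGraph.ConnectedComponent.lift_mk]

theorem componentProj_conjTranspose (B : BasisSet m d) (x : Fin m) (a : Component B) :
    (componentProj B x a).conjTranspose = componentProj B x a := by
  simp [componentProj, Matrix.conjTranspose_sum, basisProj_conjTranspose]

theorem componentProj_mul_self (B : BasisSet m d) (x : Fin m) (a : Component B) :
    componentProj B x a * componentProj B x a = componentProj B x a := by
  conv_rhs => rw [← mul_one (componentProj B x a), ← sum_componentProj B x, Finset.mul_sum]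
  exact (Finset.sum_eq_single a
    (fun b _ hb => componentProj_mul_of_ne B x x (Ne.symm hb)) (by simp)).symm

theorem basisProj_mul_componentProj (B : BasisSet m d) (x : Fin m) (k : Fin d)
    (a : Component B) [Decidable (k ∈ componentIndices B x a)] :
    basisProj B x k * componentProj B x a =
      if k ∈ componentIndices B x a then basisProj B x k else 0 := by
  rw [componentProj, Finset.mul_sum]
  split_ifs with h
  · rw [Finset.sum_eq_single k (fun l _ hl => basisProj_mul_of_ne B x hl.symm)
      (fun h' => absurd h h'), basisProj_mul_self]
  · exact Finset.sum_eq_zero fun l hl => basisProj_mul_of_ne B x fun hkl => h (hkl ▸ hl)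

/-- A component comes with a vertex of some basis `y`, perhaps not `x`; the basis-independent trace
of the projector carries nonemptiness over to `x`. -/
theorem componentRank_pos (B : BasisSet m d) (x : Fin m) (a : Component B) :
    0 < componentRank B x a := by
  induction a using SimpleGraph.ConnectedComponent.ind with
  | h v =>
    obtain ⟨y, k⟩ := v
    have h1 : componentRank B x (SimpleGraph.connectedComponentMk _ (y, k)) =
        componentRank B y (SimpleGraph.connectedComponentMk _ (y, k)) := by
      have h2 := trace_componentProj B x (SimpleGraph.connectedComponentMk _ (y, k))
      rw [componentProj_eq B x y, trace_componentProj] at h2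
      exact_mod_cast h2.symm
    rw [h1]
    exact Finset.card_pos.2 ⟨k, by simp [componentIndices]⟩

/-- The component projector is the range projection of an isometry. -/
theorem exists_isometry_componentProj (B : BasisSet m d) (x : Fin m) (a : Component B) :
    ∃ U : Matrix (Fin d) (Fin (componentRank B x a)) ℂ,
      U.conjTranspose * U = 1 ∧ U * U.conjTranspose = componentProj B x a := by
  let e : Fin (componentRank B x a) ≃ componentIndices B x a :=
    (componentIndices B x a).equivFin.symm
  refine ⟨Matrix.of fun i l => B x (e l) i, ?_, ?_⟩
  · exact (orthonormal_iff_conjTranspose_mul_self fun l => B x (e l)).1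
      ((B x).orthonormal.comp _ (Subtype.val_injective.comp e.injective))
  · rw [componentProj, ← Finset.sum_coe_sort, ← e.sum_comp]
    ext i j
    simp [Matrix.mul_apply, Matrix.sum_apply, basisProj, ketBra, Matrix.vecMulVec_apply]

/-- With P_a = U U*, the matrix W = √r U* T satisfies W W* = 1, and T = r^(-1/2) U W is a Schmidt
decomposition with equal coefficients. -/
theorem isPureMES_ketBra_ket (B : BasisSet m d) (x : Fin m) (a : Component B) {n : ℕ}
    {T : Matrix (Fin d) (Fin n) ℂ}
    (hP : componentProj B x a * T = T)
    (hT : T * T.conjTranspose = (componentRank B x a : ℂ)⁻¹ • componentProj B x a) :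
    IsPureMES (componentRank B x a) (ketBra (ket T)) := by
  obtain ⟨U, hU, hUP⟩ := exists_isometry_componentProj B x a
  have hrpos := componentRank_pos B x a
  generalize componentRank B x a = r at *
  have hr0 : (r : ℂ) ≠ 0 := Nat.cast_ne_zero.2 hrpos.ne'
  have hs0 : ((√(r : ℝ) : ℝ) : ℂ) ≠ 0 := by
    rw [Complex.ofReal_ne_zero]
    exact (Real.sqrt_pos.2 (Nat.cast_pos.2 hrpos)).ne'
  have hss : star ((√(r : ℝ) : ℝ) : ℂ) * ((√(r : ℝ) : ℝ) : ℂ) = r := by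
    have h := ofReal_sqrt_inv_mul_star r
    rw [star_inv₀, ← mul_inv, inv_inj, mul_comm] at h
    exact h
  let W : Matrix (Fin r) (Fin n) ℂ := ((√(r : ℝ) : ℝ) : ℂ) • (U.conjTranspose * T)
  have hW : W * W.conjTranspose = 1 := by
    simp only [W, Matrix.conjTranspose_smul, Matrix.smul_mul, Matrix.mul_smul, smul_smul, hss,
      Matrix.conjTranspose_mul, Matrix.conjTranspose_conjTranspose]
    rw [Matrix.mul_assoc, ← Matrix.mul_assoc T, hT, ← hUP, Matrix.smul_mul, Matrix.mul_smul,
      smul_smul, mul_inv_cancel₀ hr0, one_smul, Matrix.mul_assoc, hU, Matrix.mul_one, hU]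
  refine (isPureMES_iff _).2 ⟨U, W.transpose, hU, ?_, ?_⟩
  · have h := congrArg Matrix.transpose hW
    rwa [Matrix.transpose_mul, Matrix.transpose_one] at h
  · rw [mes, Matrix.transpose_transpose, Matrix.mul_smul, smul_smul, inv_mul_cancel₀ hs0,
      one_smul, ← Matrix.mul_assoc, hUP, hP]

/-! ### Zero-uncertainty states -/

/-- All joint probabilities are nonnegative and sum to one, and the correct guesses already account
for one. Each wrong pair thus has trace zero, which for positive operators forces the product to
vanish. -/
theorem IsZUS.exists_mul_eq_zero {n : ℕ} {B : BasisSet m d} {ρ : BiOp d n} (hρ : IsZUS B ρ)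
    (x : Fin m) : ∃ M : Fin d → Matrix (Fin n) (Fin n) ℂ,
      (∀ k, (M k).IsHermitian) ∧ ∑ k, M k = 1 ∧
        ∀ k l, k ≠ l → (basisProj B x k ⊗ₖ M l) * ρ = 0 := by
  obtain ⟨⟨hpos, htr⟩, h⟩ := hρ
  obtain ⟨M, hM, hM1, hMtr⟩ := h x
  refine ⟨M, fun k => (hM k).1, hM1, fun k l hkl => ?_⟩
  have hps : ∀ k l, (basisProj B x k ⊗ₖ M l).PosSemidef := fun k l =>
    (posSemidef_ketBra _).kronecker (hM l)
  have hnn : ∀ k l, 0 ≤ (ρ * (basisProj B x k ⊗ₖ M l)).trace := fun k l =>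
    trace_mul_nonneg_of_posSemidef hpos (hps k l)
  have hall : ∑ k, ∑ l, (ρ * (basisProj B x k ⊗ₖ M l)).trace = 1 := by
    have h1 : ∑ k, ∑ l, (basisProj B x k ⊗ₖ M l) = (1 : BiOp d n) := by
      rw [← Matrix.one_kronecker_one, ← sum_basisProj B x, ← hM1]
      ext i j
      simp [Matrix.sum_apply, Finset.sum_mul_sum]
    simp_rw [← Matrix.trace_sum, ← Finset.mul_sum]
    rw [h1, Matrix.mul_one, htr]
  have hzero : ∑ k, ∑ l ∈ Finset.univ.erase k, (ρ * (basisProj B x k ⊗ₖ M l)).trace = 0 := by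
    have h2 : ∀ k, ∑ l, (ρ * (basisProj B x k ⊗ₖ M l)).trace =
        (ρ * (basisProj B x k ⊗ₖ M k)).trace +
          ∑ l ∈ Finset.univ.erase k, (ρ * (basisProj B x k ⊗ₖ M l)).trace := fun k =>
      (Finset.add_sum_erase _ _ (Finset.mem_univ k)).symm
    simp_rw [h2, Finset.sum_add_distrib, hMtr] at hall
    exact left_eq_add.1 hall.symm
  have h3 := (Finset.sum_eq_zero_iff_of_nonneg fun k _ =>
    Finset.sum_nonneg fun l _ => hnn k l).1 hzero k (Finset.mem_univ k)
  have h4 := (Finset.sum_eq_zero_iff_of_nonneg fun l _ => hnn k l).1 h3 l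
    (Finset.mem_erase.2 ⟨hkl.symm, Finset.mem_univ l⟩)
  have h5 := congrArg Matrix.conjTranspose (mul_eq_zero_of_trace_mul_eq_zero hpos (hps k l) h4)
  rwa [Matrix.conjTranspose_mul, (hps k l).1, hpos.1, Matrix.conjTranspose_zero] at h5

/-- Since the M_j sum to one, the row ψ_l of T is unchanged by M_lᵀ, while M_lᵀ kills the row ψ_k of
S. Inserting M_lᵀ between S and T* removes the off-diagonal entries; this needs the same M for both.
-/
theorem exists_mul_conjTranspose_mul_componentProj (B : BasisSet m d) {n : ℕ}
    {S T : Matrix (Fin d) (Fin n) ℂ}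
    (h : ∀ x, ∃ M : Fin d → Matrix (Fin n) (Fin n) ℂ,
      (∀ k, (M k).IsHermitian) ∧ ∑ k, M k = 1 ∧ ∀ k l, k ≠ l →
        basisProj B x k * S * (M l).transpose = 0 ∧ basisProj B x k * T * (M l).transpose = 0) :
    ∃ c : Component B → ℂ, ∀ x a,
      S * T.conjTranspose * componentProj B x a = c a • componentProj B x a := by
  refine exists_mul_componentProj_eq_smul B _ fun x k l hkl => ?_
  obtain ⟨M, hMh, hM1, hM⟩ := h x
  have hT : basisProj B x l * T = basisProj B x l * T * (M l).transpose := by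
    conv_lhs => rw [← Matrix.mul_one (basisProj B x l * T), ← Matrix.transpose_one, ← hM1,
      Matrix.transpose_sum, Matrix.mul_sum]
    exact Finset.sum_eq_single l (fun j _ hj => (hM l j hj.symm).2) (by simp)
  have hMt : (M l).transpose.conjTranspose = (M l).transpose :=
    congrArg Matrix.transpose (hMh l)
  have hT' : T.conjTranspose * basisProj B x l =
      (M l).transpose * (T.conjTranspose * basisProj B x l) := by
    have h1 := congrArg Matrix.conjTranspose hT
    rwa [Matrix.conjTranspose_mul, Matrix.conjTranspose_mul _ (M l).transpose,
      Matrix.conjTranspose_mul, hMt, basisProj_conjTranspose] at h1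
  rw [Matrix.mul_assoc, Matrix.mul_assoc, hT', ← Matrix.mul_assoc, ← Matrix.mul_assoc,
    (hM k l hkl).1, Matrix.zero_mul]

/-- A family of mutually orthogonal projections, completed to a measurement. -/
theorem sum_conjTranspose_mul_self_option {n : ℕ} {ι : Type} [Fintype ι] [DecidableEq ι]
    (Q : ι → Matrix (Fin n) (Fin n) ℂ) (hQ : ∀ i, (Q i).conjTranspose = Q i)
    (hQQ : ∀ i j, Q i * Q j = if i = j then Q i else 0) :
    ∑ o : Option ι, (o.elim (1 - ∑ i, Q i) Q).conjTranspose * o.elim (1 - ∑ i, Q i) Q = 1 := by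
  have h1 : (∑ i, Q i) * ∑ i, Q i = ∑ i, Q i := by
    simp [Finset.sum_mul_sum, hQQ]
  rw [Fintype.sum_option]
  simp only [Option.elim, hQ, hQQ, if_true, Matrix.conjTranspose_sub, Matrix.conjTranspose_one,
    Matrix.conjTranspose_sum]
  rw [Matrix.sub_mul, Matrix.mul_sub, Matrix.mul_sub, h1]
  simp

theorem bobConj_sum_smul {m n d : ℕ} {ι : Type} [Fintype ι] (K : Matrix (Fin d) (Fin n) ℂ)
    (p : ι → ℝ) (σ : ι → BiOp m n) :
    bobConj K (∑ i, p i • σ i) = ∑ i, p i • bobConj K (σ i) := by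
  simp [bobConj, Matrix.mul_sum, Matrix.sum_mul]

/-- A state supported in one component on which Bob can guess Alice's outcomes is equivalent to
the pure maximally entangled state of the component rank. -/
theorem IsEntanglementMonotone.component_bounds {E : ∀ m n : ℕ, BiOp m n → ℝ}
    (hE : IsEntanglementMonotone E) (B : BasisSet m d) (x : Fin m) (a : Component B) {n : ℕ}
    {τ : BiOp d n} (hτ : IsState τ)
    (hP : (componentProj B x a ⊗ₖ (1 : Matrix (Fin n) (Fin n) ℂ)) * τ = τ)
    (hM : ∀ y, ∃ M : Fin d → Matrix (Fin n) (Fin n) ℂ,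
      (∀ k, (M k).IsHermitian) ∧ ∑ k, M k = 1 ∧
        ∀ k l, k ≠ l → (basisProj B y k ⊗ₖ M l) * τ = 0)
    {m' n' : ℕ} {σ : BiOp m' n'} (hσ : IsPureMES (componentRank B x a) σ) :
    E m' n' σ ≤ E d n τ ∧ (IsConvexMeasure E → E d n τ ≤ E m' n' σ) := by
  obtain ⟨p, T, hp, hτp, hvec, htr⟩ := exists_ket_decomposition hτ.1
  have hrpos := componentRank_pos B x a
  set r := componentRank B x a with hr
  have hr0 : (r : ℂ) ≠ 0 := Nat.cast_ne_zero.2 hrpos.ne'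
  -- An eigenvector with nonzero eigenvalue lies in the range of `τ`.
  have hann : ∀ i, p i ≠ 0 → ∀ (A : Matrix (Fin d) (Fin d) ℂ) (C : Matrix (Fin n) (Fin n) ℂ),
      (A ⊗ₖ C) * τ = 0 → A * T i * C.transpose = 0 := by
    intro i hi A C h
    apply ket_injective
    have h1 : (A ⊗ₖ C).mulVec (τ.mulVec (ket (T i))) = 0 := by
      rw [Matrix.mulVec_mulVec, h, Matrix.zero_mulVec]
    rw [hvec, Matrix.mulVec_smul, smul_eq_zero_iff_right hi, kronecker_mulVec_ket] at h1
    rw [h1]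
    rfl
  have hPT : ∀ i, p i ≠ 0 → componentProj B x a * T i = T i := by
    intro i hi
    have h := hann i hi (componentProj B x a - 1) 1 (by
      rw [sub_eq_add_neg, Matrix.add_kronecker, ← neg_one_smul ℂ (1 : Matrix (Fin d) (Fin d) ℂ),
        Matrix.smul_kronecker, Matrix.add_mul, hP, Matrix.one_kronecker_one, Matrix.smul_mul,
        Matrix.one_mul, neg_one_smul, add_neg_cancel])
    rwa [Matrix.transpose_one, Matrix.mul_one, Matrix.sub_mul, Matrix.one_mul, sub_eq_zero] at h
  have hTT : ∀ i j, p i ≠ 0 → p j ≠ 0 → T i * (T j).conjTranspose =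
      if i = j then (r : ℂ)⁻¹ • componentProj B x a else 0 := by
    intro i j hi hj
    obtain ⟨c, hc⟩ := exists_mul_conjTranspose_mul_componentProj B (S := T i) (T := T j) (by
      intro y
      obtain ⟨M, hMh, hM1, hMz⟩ := hM y
      exact ⟨M, hMh, hM1, fun k l hkl =>
        ⟨hann i hi _ _ (hMz k l hkl), hann j hj _ _ (hMz k l hkl)⟩⟩)
    have h1 : T i * (T j).conjTranspose = c a • componentProj B x a := by
      rw [← hc x a, Matrix.mul_assoc, ← componentProj_conjTranspose B x,
        ← Matrix.conjTranspose_mul, hPT j hj]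
    have h2 := htr i j
    -- Taking traces gives c_a r = δ_ij.
    rw [h1, Matrix.trace_smul, trace_componentProj, ← hr, smul_eq_mul] at h2
    rw [h1]
    split_ifs at h2 ⊢ with hij
    · rw [eq_inv_of_mul_eq_one_left h2]
    · rw [(mul_eq_zero_iff_right hr0).1 h2, zero_smul]
  have hmes : ∀ i, p i ≠ 0 → IsPureMES r (ketBra (ket (T i))) := fun i hi =>
    isPureMES_ketBra_ket B x a (hPT i hi) (by rw [hTT i i hi hi, if_pos rfl])
  have hval : ∀ i, p i * E d n (ketBra (ket (T i))) = p i * E m' n' σ := by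
    intro i
    by_cases hi : p i = 0
    · rw [hi, zero_mul, zero_mul]
    · rw [hE.eq_of_isPureMES hrpos (hmes i hi) hσ]
  have htrT : ∀ i, (ketBra (ket (T i))).trace = 1 := fun i => by
    rw [trace_ketBra_ket, htr, if_pos rfl]
  have hsum : ∑ i, p i = 1 := by
    have h := hτ.2
    rw [hτp, Matrix.trace_sum] at h
    simp only [Matrix.trace_smul, htrT] at h
    simpa [← Complex.ofReal_sum, ← Complex.ofReal_one, -Complex.ofReal_one] using h
  have havg : ∑ i, p i * E d n (ketBra (ket (T i))) = E m' n' σ := by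
    simp_rw [hval]
    rw [← Finset.sum_mul, hsum, one_mul]
  constructor
  -- `R i` projects onto the support of T_i on Bob's side. Eigenvectors of eigenvalue zero are
  -- dropped, since the relations say nothing about them.
  · let R : Fin d × Fin n → Matrix (Fin n) (Fin n) ℂ := fun i =>
      if p i = 0 then 0 else (r : ℂ) • ((T i).conjTranspose * T i)
    have hRh : ∀ i, (R i).conjTranspose = R i := by
      intro i
      by_cases hi : p i = 0
      · simp [R, hi]
      · simp [R, hi, Matrix.conjTranspose_smul]
    have hTR : ∀ i j, p i ≠ 0 → T i * R j = if i = j then T i else 0 := by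
      intro i j hi
      by_cases hj : p j = 0
      · rw [if_neg fun h : i = j => hi (h ▸ hj)]
        simp [R, hj]
      · simp only [R, if_neg hj]
        rw [Matrix.mul_smul, ← Matrix.mul_assoc, hTT i j hi hj]
        split_ifs with hij
        · rw [Matrix.smul_mul, smul_smul, mul_inv_cancel₀ hr0, one_smul, ← hij, hPT i hi]
        · rw [Matrix.zero_mul, smul_zero]
    have hRR : ∀ i j, R i * R j = if i = j then R i else 0 := by
      intro i j
      by_cases hi : p i = 0
      · simp [R, hi]
      · have h1 : R i = (r : ℂ) • ((T i).conjTranspose * T i) := if_neg hi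
        rw [h1, Matrix.smul_mul, Matrix.mul_assoc, hTR i j hi]
        split_ifs with hij
        · rfl
        · rw [Matrix.mul_zero, smul_zero]
    let Q : Fin d × Fin n → Matrix (Fin n) (Fin n) ℂ := fun i => (R i).transpose
    have hQh : ∀ i, (Q i).conjTranspose = Q i := fun i => congrArg Matrix.transpose (hRh i)
    have hQQ : ∀ i j, Q i * Q j = if i = j then Q i else 0 := by
      intro i j
      simp only [Q]
      rw [← Matrix.transpose_mul, hRR]
      by_cases h : i = j
      · simp [h]
      · simp [h, Ne.symm h]
    have key := hE.bob_selective hτ (fun o : Option (Fin d × Fin n) => o.elim (1 - ∑ i, Q i) Q)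
      (sum_conjTranspose_mul_self_option Q hQh hQQ) (fun o => o.elim 0 p)
      (fun o => o.elim 0 fun i => ketBra (ket (T i)))
      (by
        have hterm : ∀ (L : Matrix (Fin n) (Fin n) ℂ) (A : BiOp d n) i,
            (p i ≠ 0 → ketBra (ket (T i * L.transpose)) = A) →
              p i • bobConj L (ketBra (ket (T i))) = p i • A := by
          intro L A i h
          by_cases hi : p i = 0
          · rw [hi, zero_smul, zero_smul]
          · rw [bobConj_ketBra, h hi]
        rintro (_ | j)
        · rw [hτp, bobConj_sum_smul]
          simp only [Option.elim, zero_smul]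
          refine Finset.sum_eq_zero fun i _ => ?_
          rw [hterm _ 0 i, smul_zero]
          intro hi
          have h0 : T i * (1 - ∑ j, Q j).transpose = 0 := by
            simp only [Q, Matrix.transpose_sub, Matrix.transpose_one, Matrix.transpose_sum,
              Matrix.transpose_transpose, Matrix.mul_sub, Matrix.mul_one, Matrix.mul_sum,
              hTR i _ hi]
            simp
          rw [h0, ketBra_ket_zero]
        · rw [hτp, bobConj_sum_smul]
          simp only [Option.elim]
          rw [Finset.sum_eq_single j]
          · refine hterm _ _ j fun hj => ?_
            simp only [Q, Matrix.transpose_transpose]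
            rw [hTR j j hj, if_pos rfl]
          · intro i _ hij
            rw [hterm _ 0 i, smul_zero]
            intro hi
            simp only [Q, Matrix.transpose_transpose]
            rw [hTR i j hi, if_neg hij, ketBra_ket_zero]
          · simp)
      (by
        rintro (_ | i) h
        · exact absurd rfl h
        · exact htrT i)
    simp only [Fintype.sum_option, Option.elim, zero_mul, zero_add] at key
    rwa [havg] at key
  · intro hconv
    rw [← havg, hτp]
    exact (hconv d n).map_sum_le (fun i _ => hp i) hsum fun i _ =>
      ⟨posSemidef_ketBra _, htrT i⟩

/-! ### The blocks of a state -/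

/-- The unnormalized part of `ρ` in the component `a`. -/
noncomputable def block {n : ℕ} (B : BasisSet m d) (x : Fin m) (ρ : BiOp d n) (a : Component B) :
    BiOp d n :=
  (componentProj B x a ⊗ₖ (1 : Matrix (Fin n) (Fin n) ℂ)) * ρ *
    (componentProj B x a ⊗ₖ (1 : Matrix (Fin n) (Fin n) ℂ))

theorem kronecker_one_conjTranspose {n : ℕ} {A : Matrix (Fin d) (Fin d) ℂ}
    (hA : A.conjTranspose = A) :
    (A ⊗ₖ (1 : Matrix (Fin n) (Fin n) ℂ)).conjTranspose = A ⊗ₖ 1 := by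
  rw [Matrix.conjTranspose_kronecker, hA, Matrix.conjTranspose_one]

theorem aliceConj_componentProj {n : ℕ} (B : BasisSet m d) (x : Fin m) (ρ : BiOp d n)
    (a : Component B) : aliceConj (componentProj B x a) ρ = block B x ρ a := by
  rw [aliceConj, kronecker_one_conjTranspose (componentProj_conjTranspose B x a), block]

theorem componentProj_kronecker_mul_self {n : ℕ} (B : BasisSet m d) (x : Fin m)
    (a : Component B) :
    (componentProj B x a ⊗ₖ (1 : Matrix (Fin n) (Fin n) ℂ)) * (componentProj B x a ⊗ₖ 1) =
      componentProj B x a ⊗ₖ 1 := by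
  rw [← Matrix.mul_kronecker_mul, componentProj_mul_self, Matrix.one_mul]

theorem componentProj_kronecker_mul_block {n : ℕ} (B : BasisSet m d) (x : Fin m) (ρ : BiOp d n)
    (a : Component B) :
    (componentProj B x a ⊗ₖ (1 : Matrix (Fin n) (Fin n) ℂ)) * block B x ρ a = block B x ρ a := by
  rw [block, ← Matrix.mul_assoc, ← Matrix.mul_assoc, componentProj_kronecker_mul_self]

theorem block_mul_componentProj_kronecker {n : ℕ} (B : BasisSet m d) (x : Fin m) (ρ : BiOp d n)
    (a : Component B) :
    block B x ρ a * (componentProj B x a ⊗ₖ (1 : Matrix (Fin n) (Fin n) ℂ)) = block B x ρ a := by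
  rw [block, Matrix.mul_assoc, componentProj_kronecker_mul_self]

/-- Measuring the components of ρ_𝓑 gives the same blocks as measuring those of ρ, so the bound on
E(ρ_𝓑) is expressed by the data of ρ. -/
theorem block_decohere {n : ℕ} (B : BasisSet m d) (x : Fin m) (ρ : BiOp d n)
    (a : Component B) : block B x (decohere B x ρ) a = block B x ρ a := by
  have h : decohere B x ρ = ∑ b, block B x ρ b := rfl
  rw [block, h, Matrix.mul_sum, Matrix.sum_mul, Finset.sum_eq_single a]
  · rw [componentProj_kronecker_mul_block, block_mul_componentProj_kronecker]
  · intro b _ hb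
    rw [← componentProj_kronecker_mul_block B x ρ b, ← Matrix.mul_assoc,
      ← Matrix.mul_kronecker_mul, componentProj_mul_of_ne B x x hb.symm, Matrix.zero_kronecker,
      Matrix.zero_mul, Matrix.zero_mul]
  · simp

theorem posSemidef_block {n : ℕ} (B : BasisSet m d) (x : Fin m) {ρ : BiOp d n}
    (hρ : ρ.PosSemidef) (a : Component B) : (block B x ρ a).PosSemidef := by
  rw [← aliceConj_componentProj]
  exact hρ.mul_mul_conjTranspose_same _

theorem trace_block {n : ℕ} (B : BasisSet m d) (x : Fin m) {ρ : BiOp d n}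
    (hρ : ρ.PosSemidef) (a : Component B) :
    (block B x ρ a).trace = (componentVector B x ρ a : ℂ) := by
  have h : (block B x ρ a).trace =
      (ρ * (componentProj B x a ⊗ₖ (1 : Matrix (Fin n) (Fin n) ℂ))).trace := by
    rw [block, Matrix.trace_mul_comm, ← Matrix.mul_assoc, componentProj_kronecker_mul_self,
      Matrix.trace_mul_comm]
  rw [componentVector, ← h]
  have h0 := (posSemidef_block B x hρ a).trace_nonneg
  exact Complex.ext rfl (Complex.nonneg_iff.1 h0).2.symm

theorem componentVector_nonneg {n : ℕ} (B : BasisSet m d) (x : Fin m) {ρ : BiOp d n}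
    (hρ : ρ.PosSemidef) (a : Component B) : 0 ≤ componentVector B x ρ a := by
  have h0 := (posSemidef_block B x hρ a).trace_nonneg
  rw [trace_block B x hρ] at h0
  exact_mod_cast h0

theorem sum_componentVector {n : ℕ} (B : BasisSet m d) (x : Fin m) {ρ : BiOp d n}
    (hρ : IsState ρ) : ∑ a, componentVector B x ρ a = 1 := by
  have h1 : ∑ a, (componentProj B x a ⊗ₖ (1 : Matrix (Fin n) (Fin n) ℂ)) = 1 := by
    rw [← Matrix.one_kronecker_one, ← sum_componentProj B x]
    ext i j
    simp [Matrix.sum_apply, Finset.sum_mul]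
  simp only [componentVector]
  rw [← Complex.re_sum, ← Matrix.trace_sum, ← Matrix.mul_sum, h1, Matrix.mul_one, hρ.2,
    Complex.one_re]

theorem isState_decohere {n : ℕ} (B : BasisSet m d) (x : Fin m) {ρ : BiOp d n}
    (hρ : IsState ρ) : IsState (decohere B x ρ) := by
  refine ⟨Matrix.posSemidef_sum _ fun a _ => posSemidef_block B x hρ.1 a, ?_⟩
  have h : decohere B x ρ = ∑ b, block B x ρ b := rfl
  rw [h, Matrix.trace_sum]
  simp_rw [trace_block B x hρ.1]
  rw [← Complex.ofReal_sum, sum_componentVector B x hρ, Complex.ofReal_one]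

theorem sum_componentProj_conjTranspose_mul_self (B : BasisSet m d) (x : Fin m) :
    ∑ a, (componentProj B x a).conjTranspose * componentProj B x a = 1 := by
  simp_rw [componentProj_conjTranspose, componentProj_mul_self]
  exact sum_componentProj B x

/-- The normalized part of `ρ` in the component `a`, or `ρ` itself if that part vanishes. -/
theorem exists_isState_block_eq_smul {n : ℕ} (B : BasisSet m d) (x : Fin m) {ρ : BiOp d n}
    (hρ : IsState ρ) (a : Component B) :
    ∃ τ, IsState τ ∧ block B x ρ a = componentVector B x ρ a • τ := by
  have htr := trace_block B x hρ.1 a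
  by_cases hq : componentVector B x ρ a = 0
  · refine ⟨ρ, hρ, ?_⟩
    rw [hq, Complex.ofReal_zero] at htr
    rw [hq, zero_smul, ← (posSemidef_block B x hρ.1 a).trace_eq_zero_iff, htr]
  · refine ⟨(componentVector B x ρ a)⁻¹ • block B x ρ a,
      ⟨(posSemidef_block B x hρ.1 a).smul (inv_nonneg.2 (componentVector_nonneg B x hρ.1 a)),
        ?_⟩, ?_⟩
    · rw [Matrix.trace_smul, htr, Complex.real_smul, ← Complex.ofReal_mul, inv_mul_cancel₀ hq,
        Complex.ofReal_one]
    · rw [smul_smul, mul_inv_cancel₀ hq, one_smul]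

/-- Computed from the basis `y`, the projector P_a either fixes or kills each projector of `y`; so
the operators `M` for `ρ` also serve for its blocks. -/
theorem IsZUS.exists_mul_block_eq_zero {n : ℕ} {B : BasisSet m d} {ρ : BiOp d n}
    (hρ : IsZUS B ρ) (x : Fin m) (a : Component B) (y : Fin m) :
    ∃ M : Fin d → Matrix (Fin n) (Fin n) ℂ,
      (∀ k, (M k).IsHermitian) ∧ ∑ k, M k = 1 ∧
        ∀ k l, k ≠ l → (basisProj B y k ⊗ₖ M l) * block B x ρ a = 0 := by
  classical
  obtain ⟨M, hMh, hM1, hM⟩ := hρ.exists_mul_eq_zero y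
  refine ⟨M, hMh, hM1, fun k l hkl => ?_⟩
  rw [block, componentProj_eq B x y, ← Matrix.mul_assoc, ← Matrix.mul_assoc,
    ← Matrix.mul_kronecker_mul, basisProj_mul_componentProj, Matrix.mul_one]
  split_ifs
  · rw [hM k l hkl, Matrix.zero_mul]
  · rw [Matrix.zero_kronecker, Matrix.zero_mul, Matrix.zero_mul]

theorem minComponentRank_le (B : BasisSet m d) (x : Fin m) (a : Component B) :
    minComponentRank B x ≤ componentRank B x a :=
  ciInf_le (OrderBot.bddBelow _) a

/-- The infimum is attained over a nonempty index set; over an empty one it would be 0 in `ℕ`. -/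
theorem minComponentRank_pos (B : BasisSet m d) (x : Fin m) [Nonempty (Component B)] :
    0 < minComponentRank B x := by
  obtain ⟨a, ha⟩ := Nat.sInf_mem (Set.range_nonempty (componentRank B x))
  exact (componentRank_pos B x a).trans_eq ha

end ZeroUncertainty

/-! ### The chain of inequalities -/

theorem theorem5
    (E : ∀ m n : ℕ, BiOp m n → ℝ) (hE : IsEntanglementMonotone E)
    (dA dB m : ℕ) (B : BasisSet m dA) (x : Fin m)
    (ρ : BiOp dA dB) (hρ : IsZUS B ρ)
    (mΦ nΦ : ℕ → ℕ) (Φ : ∀ r : ℕ, BiOp (mΦ r) (nΦ r))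
    (hΦ : ∀ r : ℕ, 0 < r → IsPureMES r (Φ r)) :
    E dA dB (decohere B x ρ) ≤ E dA dB ρ ∧
    ∑ a : Component B, componentVector B x ρ a *
        E _ _ (Φ (componentRank B x a)) ≤ E dA dB (decohere B x ρ) ∧
    E _ _ (Φ (minComponentRank B x)) ≤
      ∑ a : Component B, componentVector B x ρ a * E _ _ (Φ (componentRank B x a)) ∧
    (IsConvexMeasure E →
      E dA dB (decohere B x ρ) =
        ∑ a : Component B, componentVector B x ρ a * E _ _ (Φ (componentRank B x a))) := by
  have hK := sum_componentProj_conjTranspose_mul_self B x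
  have hq := componentVector_nonneg B x hρ.1.1
  have hq1 := sum_componentVector B x hρ.1
  have hdec := isState_decohere B x hρ.1
  choose τ hτ hτb using exists_isState_block_eq_smul B x hρ.1
  have hbounds : ∀ a, componentVector B x ρ a ≠ 0 →
      E _ _ (Φ (componentRank B x a)) ≤ E dA dB (τ a) ∧
        (IsConvexMeasure E → E dA dB (τ a) ≤ E _ _ (Φ (componentRank B x a))) := by
    intro a ha
    refine hE.component_bounds B x a (hτ a) ?_ (fun y => ?_) (hΦ _ (componentRank_pos B x a))
    · have h := componentProj_kronecker_mul_block B x ρ a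
      rw [hτb, Matrix.mul_smul] at h
      exact smul_right_injective _ ha h
    · obtain ⟨M, hMh, hM1, hM⟩ := hρ.exists_mul_block_eq_zero x a y
      refine ⟨M, hMh, hM1, fun k l hkl => ?_⟩
      have h := hM k l hkl
      rwa [hτb, Matrix.mul_smul, smul_eq_zero_iff_right ha] at h
  have hlower : ∑ a, componentVector B x ρ a * E _ _ (Φ (componentRank B x a)) ≤
      E dA dB (decohere B x ρ) := by
    -- The selective measurement is applied to ρ_𝓑, not to ρ, so that E(ρ_𝓑) is the upper bound.
    refine le_trans (Finset.sum_le_sum fun a _ => ?_)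
      (hE.alice_selective hdec (componentProj B x) hK (componentVector B x ρ) τ
        (fun a => by rw [aliceConj_componentProj, block_decohere, hτb]) fun a _ => (hτ a).2)
    by_cases ha : componentVector B x ρ a = 0
    · rw [ha, zero_mul, zero_mul]
    · exact mul_le_mul_of_nonneg_left (hbounds a ha).1 (hq a)
  refine ⟨?_, hlower, ?_, fun hconv => le_antisymm ?_ hlower⟩
  · refine hE.alice_nonselective hρ.1 (componentProj B x) hK ?_ hdec.2
    simp_rw [aliceConj_componentProj]
    rfl
  · rw [← one_mul (E _ _ (Φ (minComponentRank B x))), ← hq1, Finset.sum_mul]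
    refine Finset.sum_le_sum fun a _ => mul_le_mul_of_nonneg_left ?_ (hq a)
    have : Nonempty (Component B) := ⟨a⟩
    exact hE.le_of_isPureMES_of_le (minComponentRank_pos B x) (minComponentRank_le B x a)
      (hΦ _ (componentRank_pos B x a)) (hΦ _ (minComponentRank_pos B x))
  -- This is a convex combination of states even at weight zero, where `τ a` is still a state.
  · have h : decohere B x ρ = ∑ a, componentVector B x ρ a • τ a :=
      Finset.sum_congr rfl fun a _ => hτb a
    rw [h]
    refine ((hconv dA dB).map_sum_le (fun a _ => hq a) hq1 fun a _ => hτ a).trans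
      (Finset.sum_le_sum fun a _ => ?_)
    by_cases ha : componentVector B x ρ a = 0
    · rw [ha, smul_eq_mul, zero_mul, zero_mul]
    · exact mul_le_mul_of_nonneg_left ((hbounds a ha).2 hconv) (hq a)
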